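/- Let $n\ge 1$, let $\gamma$ be the standard Gaussian measure on $\mathbb{R}^n$, and let $W_k(x)=x_1+\dots+x_k$ for $0\le k\le n$ (so $W_0=0$). Put $A_n=\bigcap_{k=0}^n\{W_k\le 0\}$. Then $$\gamma(A_n)=\binom{2n}{n}\frac1{4^n}.$$ For $u\in L^2(\gamma)$, the measure-derivative $D_\gamma u$ of $u$ (if it exists) is the $\mathbb{R}^n$-valued Borel measure of finite total variation such that $$\int g\,d\langle D_\gamma u,h\rangle=-\int u\,\big(\partial_h g-g\,\langle h,\cdot\rangle\big)\,d\gamma$$ for every $h\in\mathbb{R}^n$ and every smooth $g:\mathbb{R}^n\to\mathbb{R}$ that is bounded together with all its derivatives. Let $|D_\gamma u|$ denote its total variation measure. For $u=I_{\{W_n>0\}}$ the measure-derivative exists and is unique, the Gaussian perimeter $P_\gamma\{W_n>0\}=|D_\gamma I_{\{W_n>0\}}|(\mathbb{R}^n)$ is positive and finite, and $$\gamma(A_n\mid W_n=0):=\frac{|D_\gamma I_{\{W_n>0\}}|(A_n)}{P_\gamma\{W_n>0\}}=\frac1n .$$ -/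

import Mathlib

open MeasureTheory ProbabilityTheory
open scoped ENNReal

noncomputable section

namespace GaussianWalk

/-- The standard Gaussian measure `γ = γ_n` on `ℝⁿ`. -/
abbrev γ (n : ℕ) : Measure (EuclideanSpace ℝ (Fin n)) :=
  stdGaussian (EuclideanSpace ℝ (Fin n))

/-- The walk `W_k(x) = x_1 + ⋯ + x_k` (for `0 ≤ k ≤ n`), so that `W_0 = 0`. -/
def W (n k : ℕ) (x : EuclideanSpace ℝ (Fin n)) : ℝ :=
  ∑ i : Fin n with i.val < k, x i

/-- `A_n = ⋂_{k=0}^n {W_k ≤ 0}`. -/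
def A (n : ℕ) : Set (EuclideanSpace ℝ (Fin n)) :=
  {x | ∀ k ≤ n, W n k x ≤ 0}

/-- Test functions: smooth functions on `ℝⁿ` that are bounded together with all their
derivatives. -/
structure IsTestFunction {n : ℕ} (g : EuclideanSpace ℝ (Fin n) → ℝ) : Prop where
  contDiff : ContDiff ℝ (⊤ : ℕ∞) g
  bounded : ∀ k : ℕ, ∃ C : ℝ, ∀ x, ‖iteratedFDeriv ℝ k g x‖ ≤ C

/-- `∂*_h g = ∂_h g - g ⟨h, ·⟩`; the operator `-∂*_h` is the adjoint in `L²(γ)` of the directional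
derivative `∂_h`. -/
def adjDeriv {n : ℕ} (h : EuclideanSpace ℝ (Fin n)) (g : EuclideanSpace ℝ (Fin n) → ℝ)
    (x : EuclideanSpace ℝ (Fin n)) : ℝ :=
  fderiv ℝ g x h - g x * inner ℝ h x

/-- The signed measure `⟨D, h⟩` for an `ℝⁿ`-valued measure `D` and a vector `h`. -/
def component {n : ℕ} (D : VectorMeasure (EuclideanSpace ℝ (Fin n)) (EuclideanSpace ℝ (Fin n)))
    (h : EuclideanSpace ℝ (Fin n)) : SignedMeasure (EuclideanSpace ℝ (Fin n)) :=
  D.mapRange (innerSL ℝ h : EuclideanSpace ℝ (Fin n) →+ ℝ) (innerSL ℝ h).continuous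

/-- The `ℝⁿ`-valued measure `D` is the measure-derivative `D_γ u` of `u ∈ L²(γ)`: it has finite
total variation and `∫ g d⟨D, h⟩ = - ∫ u ∂*_h g dγ` for all directions `h` and all test
functions `g`. -/
structure IsMeasureDeriv {n : ℕ} (u : EuclideanSpace ℝ (Fin n) → ℝ)
    (D : VectorMeasure (EuclideanSpace ℝ (Fin n)) (EuclideanSpace ℝ (Fin n))) : Prop where
  memLp : MemLp u 2 (γ n)
  finite_variation : IsFiniteMeasure D.variation
  integral_eq : ∀ (h : EuclideanSpace ℝ (Fin n)) (g : EuclideanSpace ℝ (Fin n) → ℝ),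
    IsTestFunction g → ∫ᵛ x, g x ∂•(component D h) = - ∫ x, u x * adjDeriv h g x ∂(γ n)

open Classical in
/-- The measure-derivative `D_γ u` of a function `u` of bounded variation with respect to `γ`
(and `0` if `u` is not of bounded variation). -/
def measureDeriv {n : ℕ} (u : EuclideanSpace ℝ (Fin n) → ℝ) :
    VectorMeasure (EuclideanSpace ℝ (Fin n)) (EuclideanSpace ℝ (Fin n)) :=
  if hu : ∃ D, IsMeasureDeriv u D then hu.choose else 0

/-- The Gaussian perimeter measure `|D_γ I_E|` of a set `E`; its total mass is the Gaussian
perimeter `P_γ(E)`. -/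
def perimeterMeasure {n : ℕ} (E : Set (EuclideanSpace ℝ (Fin n))) :
    Measure (EuclideanSpace ℝ (Fin n)) :=
  (measureDeriv (E.indicator fun _ => (1 : ℝ))).variation

/-- `γ(B | W_n = 0) = |D_γ I_{W_n > 0}|(B) / P_γ{W_n > 0}`. -/
def condProbTerminalZero (n : ℕ) (B : Set (EuclideanSpace ℝ (Fin n))) : ℝ :=
  (perimeterMeasure {x | 0 < W n n x}).real B /
    (perimeterMeasure {x | 0 < W n n x}).real Set.univ

end GaussianWalk

end

/-! For the unconditioned walk, split according to the time `k` at which the maximum is attained;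
ties are null. Seen from time `k`, the later increments and the earlier increments, reversed and
negated, form two independent Gaussian walks, and the maximum is at `k` exactly when both stay
nonpositive (`measureReal_maxAt`). So `p n = γ (A n)` has self-convolution constantly `1`, and with
`p 0 = 1` this determines the sequence as `centralBinom n / 4 ^ n`.

For the conditioned walk, let `e` be the unit diagonal vector. Gaussian integration by parts on
lines parallel and orthogonal to `e` shows that the derivative of the half-space indicator is `e`
times a constant multiple of the law of the Gaussian projected to the hyperplane orthogonal to `e`
(`isMeasureDeriv_halfSpace`). It is the only candidate, because sines and cosines of linear forms
are test functions and characteristic functions determine measures. The conditional probability is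
therefore that of `bridgeMeasure`. This law is invariant under cyclic shifts of the increments, and
on closed paths a shift moves the time of the maximum by one, so the `n` possible times are equally
likely (`bridgeMeasure_measureReal_A`). -/

noncomputable section

namespace GaussianWalk

/-! ### Central binomial coefficients and their generating function -/

/-- The convolution identity for central binomial coefficients. -/
theorem sum_antidiagonal_centralBinom (n : ℕ) :
    ∑ p ∈ Finset.HasAntidiagonal.antidiagonal n, (Nat.centralBinom p.1 : ℝ) * Nat.centralBinom p.2 = 4 ^ n := by
  let C : PowerSeries ℝ := PowerSeries.mk fun n => (Nat.centralBinom n : ℝ)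
  -- The recurrence for central binomial coefficients, read as a differential equation for `C`.
  have hC : (1 - 4 * PowerSeries.X) * PowerSeries.derivative ℝ C = 2 * C := by
    ext k
    have h := Nat.succ_mul_centralBinom_succ k
    have h' : ((k : ℝ) + 1) * Nat.centralBinom (k + 1) = 2 * (2 * k + 1) * Nat.centralBinom k := by
      exact_mod_cast h
    have e4 : (4 : PowerSeries ℝ) = PowerSeries.C (4 : ℝ) := (map_ofNat PowerSeries.C 4).symm
    have e2 : (2 : PowerSeries ℝ) = PowerSeries.C (2 : ℝ) := (map_ofNat PowerSeries.C 2).symm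
    rw [sub_mul, one_mul, mul_assoc, e4, e2, map_sub, PowerSeries.coeff_C_mul,
      PowerSeries.coeff_C_mul]
    cases k with
    | zero => simpa [C, PowerSeries.coeff_derivative] using h'
    | succ k =>
      simp only [PowerSeries.coeff_succ_X_mul, PowerSeries.coeff_derivative, C,
        PowerSeries.coeff_mk]
      push_cast at h' ⊢
      linarith
  -- The equation makes `(1 - 4X) C²` constant, so `C²` is the geometric series of ratio `4`; no
  -- square root of a power series is needed.
  have hD : PowerSeries.derivative ℝ ((1 - 4 * PowerSeries.X) * (C * C)) =
      PowerSeries.derivative ℝ (1 : PowerSeries ℝ) := by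
    have h4 : PowerSeries.derivative ℝ (4 : PowerSeries ℝ) = 0 := by
      have e4 : (4 : PowerSeries ℝ) = PowerSeries.C (4 : ℝ) := (map_ofNat PowerSeries.C 4).symm
      rw [e4, PowerSeries.derivative_C]
    simp only [Derivation.leibniz, map_sub, Derivation.map_one_eq_zero, smul_eq_mul, h4,
      PowerSeries.derivative_X]
    linear_combination (2 * C) * hC
  have h1 : (1 - 4 * PowerSeries.X) * (C * C) = 1 := by
    refine PowerSeries.derivative.ext hD ?_
    simp [C]
  have h2 : (C * C) = PowerSeries.mk fun n => (4 : ℝ) ^ n := by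
    have h3 : (1 - 4 * PowerSeries.X) * (PowerSeries.mk fun n => (4 : ℝ) ^ n) = 1 := by
      ext k
      have e4 : (4 : PowerSeries ℝ) = PowerSeries.C (4 : ℝ) := (map_ofNat PowerSeries.C 4).symm
      rw [sub_mul, one_mul, mul_assoc, e4, map_sub, PowerSeries.coeff_C_mul]
      cases k with
      | zero => simp
      | succ k => simp [PowerSeries.coeff_succ_X_mul, PowerSeries.coeff_one, pow_succ']
    calc C * C = (C * C) * ((1 - 4 * PowerSeries.X) * (PowerSeries.mk fun n => (4 : ℝ) ^ n)) := by
          rw [h3, mul_one]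
      _ = ((1 - 4 * PowerSeries.X) * (C * C)) * (PowerSeries.mk fun n => (4 : ℝ) ^ n) := by ring
      _ = _ := by rw [h1, one_mul]
  have := congrArg (PowerSeries.coeff n) h2
  simpa [PowerSeries.coeff_mul, C] using this

/-- A sequence starting at `1` whose self-convolution is constantly `1` is the sequence of
normalized central binomial coefficients. -/
theorem eq_centralBinom_of_sum_antidiagonal_eq_one {p : ℕ → ℝ} (h0 : p 0 = 1)
    (hp : ∀ n, ∑ q ∈ Finset.HasAntidiagonal.antidiagonal n, p q.1 * p q.2 = 1) (n : ℕ) :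
    p n = Nat.centralBinom n / 4 ^ n := by
  induction n using Nat.strong_induction_on with
  | _ n ih =>
    cases n with
    | zero => simp [h0]
    | succ n =>
      let q : ℕ → ℝ := fun n => Nat.centralBinom n / 4 ^ n
      have hq : ∑ r ∈ Finset.HasAntidiagonal.antidiagonal (n + 1), q r.1 * q r.2 = 1 := by
        have := sum_antidiagonal_centralBinom (n + 1)
        rw [← div_eq_one_iff_eq (by positivity), Finset.sum_div] at this
        rw [← this]
        refine Finset.sum_congr rfl fun r hr => ?_
        rw [← Finset.HasAntidiagonal.mem_antidiagonal.1 hr, pow_add, div_mul_div_comm]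
      have h1 := hp (n + 1)
      rw [Finset.Nat.sum_antidiagonal_succ] at hq h1
      cases n with
      | zero =>
        simp [h0] at h1
        simp [Nat.centralBinom, Nat.choose]
        linarith
      | succ n =>
        -- With both end terms peeled off, the interior involves only smaller indices, and the two
        -- ends contribute twice the unknown value.
        rw [Finset.Nat.sum_antidiagonal_succ'] at hq h1
        have hs : ∑ r ∈ Finset.HasAntidiagonal.antidiagonal n, p (r.1 + 1) * p (r.2 + 1) =
            ∑ r ∈ Finset.HasAntidiagonal.antidiagonal n, q (r.1 + 1) * q (r.2 + 1) := by
          refine Finset.sum_congr rfl fun r hr => ?_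
          have := Finset.HasAntidiagonal.mem_antidiagonal.1 hr
          rw [ih _ (by omega), ih _ (by omega)]
        have hq0 : q 0 = 1 := by simp [q]
        simp only [h0, hq0] at hq h1
        simp only [hs] at h1
        change p (n + 1 + 1) = q (n + 1 + 1)
        linarith

/-! ### The walk and the time of its maximum -/

/-- A nonzero linear form has a nondegenerate Gaussian law, hence no atoms. This is what makes ties
between maxima negligible. -/
theorem stdGaussian_inner_eq_zero {n : ℕ} {v : EuclideanSpace ℝ (Fin n)} (hv : v ≠ 0) :
    γ n {x | inner ℝ v x = 0} = 0 := by
  have h : (γ n).map (innerSL ℝ v) = gaussianReal 0 (‖v‖₊ ^ 2) := by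
    rw [IsGaussian.map_eq_gaussianReal, variance_dual_stdGaussian, integral_strongDual_stdGaussian,
      innerSL_apply_norm]
    congr 1
    ext
    simp
  have hne : (‖v‖₊ ^ 2) ≠ 0 := by simpa using hv
  have := nullSingletonClass_gaussianReal (μ := 0) hne
  have h2 : (γ n).map (innerSL ℝ v) {0} = 0 := by rw [h]; simp
  rw [Measure.map_apply (by fun_prop) (by simp)] at h2
  exact h2

theorem W_eq_sum_ite (n k : ℕ) (x : EuclideanSpace ℝ (Fin n)) :
    W n k x = ∑ i : Fin n, if i.val < k then x i else 0 := by
  rw [W, Finset.sum_filter]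

/-- The vector representing the linear form `W_k`. -/
def walkVector (n k : ℕ) : EuclideanSpace ℝ (Fin n) :=
  WithLp.toLp 2 fun i => if i.val < k then 1 else 0

theorem inner_walkVector (n k : ℕ) (x : EuclideanSpace ℝ (Fin n)) :
    inner ℝ (walkVector n k) x = W n k x := by
  simp [W_eq_sum_ite, walkVector, PiLp.inner_apply]

@[fun_prop]
theorem continuous_W (n k : ℕ) : Continuous (W n k) := by
  unfold W; fun_prop

theorem W_zero (n : ℕ) (x : EuclideanSpace ℝ (Fin n)) : W n 0 x = 0 := by
  simp [W]

theorem walkVector_sub_ne_zero {n j k : ℕ} (hjk : j < k) (hk : k ≤ n) :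
    walkVector n k - walkVector n j ≠ 0 := by
  intro h
  have := congrArg (fun v : EuclideanSpace ℝ (Fin n) => v ⟨j, by omega⟩) h
  simp [walkVector, hjk] at this

/-- The set of paths whose maximum over the times `0, …, n` is attained at time `j`. -/
def maxAt (n j : ℕ) : Set (EuclideanSpace ℝ (Fin n)) :=
  {x | ∀ k ≤ n, W n k x ≤ W n j x}

theorem maxAt_zero (n : ℕ) : maxAt n 0 = A n := by
  simp [maxAt, A, W_zero]

theorem measurableSet_maxAt (n j : ℕ) : MeasurableSet (maxAt n j) := by
  have : maxAt n j = ⋂ k, ⋂ _ : k ≤ n, {x | W n k x ≤ W n j x} := by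
    ext; simp [maxAt]
  rw [this]
  exact .iInter fun k => .iInter fun _ =>
    measurableSet_le (by fun_prop : Continuous (W n k)).measurable
      (by fun_prop : Continuous (W n j)).measurable

theorem measurableSet_A (n : ℕ) : MeasurableSet (A n) :=
  maxAt_zero n ▸ measurableSet_maxAt n 0

theorem exists_mem_maxAt (n : ℕ) (x : EuclideanSpace ℝ (Fin n)) :
    ∃ j ∈ Finset.range (n + 1), x ∈ maxAt n j := by
  obtain ⟨j, hj, h⟩ := Finset.exists_max_image (Finset.range (n + 1)) (fun k => W n k x)
    ⟨0, by simp⟩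
  exact ⟨j, hj, fun k hk => h k (by simp; omega)⟩

theorem sum_measureReal_eq_one_of_cover {α ι : Type*} [MeasurableSpace α] {μ : Measure α}
    [IsProbabilityMeasure μ] (s : Finset ι) {B : ι → Set α} (hB : ∀ i ∈ s, MeasurableSet (B i))
    (hd : ∀ i ∈ s, ∀ j ∈ s, i ≠ j → μ (B i ∩ B j) = 0)
    (hc : ∀ᵐ x ∂μ, ∃ i ∈ s, x ∈ B i) : ∑ i ∈ s, μ.real (B i) = 1 := by
  have h1 : μ (⋃ i ∈ s, B i) = ∑ i ∈ s, μ (B i) :=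
    measure_biUnion_finset₀ (fun i hi j hj hij => hd i hi j hj hij)
      fun i hi => (hB i hi).nullMeasurableSet
  have h2 : μ (⋃ i ∈ s, B i) = 1 := by
    rw [← measure_univ (μ := μ)]
    refine measure_congr (Filter.eventuallyEq_univ.2 ?_)
    filter_upwards [hc] with x hx
    simpa using hx
  have h3 := h1.symm.trans h2
  simp only [Measure.real]
  rw [← ENNReal.toReal_sum (fun i _ => measure_ne_top _ _), h3, ENNReal.toReal_one]

theorem measure_maxAt_inter_eq_zero {n i j : ℕ} (hi : i ≤ n) (hj : j ≤ n) (hij : i ≠ j) :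
    γ n (maxAt n i ∩ maxAt n j) = 0 := by
  wlog h : i < j generalizing i j
  · rw [Set.inter_comm]
    exact this hj hi hij.symm (by omega)
  refine measure_mono_null ?_ (stdGaussian_inner_eq_zero (walkVector_sub_ne_zero h hj))
  rintro x ⟨h1, h2⟩
  simp only [Set.mem_ofPred_eq, inner_sub_left, inner_walkVector]
  linarith [h1 j hj, h2 i hi]

/-! ### Splitting and reversing the path at its maximum -/

/-- The standard Gaussian measure on the coordinate space `Fin n → ℝ`. -/
abbrev gaussianPi (n : ℕ) : Measure (Fin n → ℝ) := Measure.pi fun _ => gaussianReal 0 1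

theorem measurePreserving_toLp (n : ℕ) :
    MeasurePreserving (WithLp.toLp 2 : (Fin n → ℝ) → EuclideanSpace ℝ (Fin n))
      (gaussianPi n) (γ n) :=
  ⟨by fun_prop, map_pi_eq_stdGaussian⟩

theorem measurePreserving_append (k m : ℕ) :
    MeasurePreserving (fun p : (Fin k → ℝ) × (Fin m → ℝ) => Fin.append p.1 p.2)
      ((gaussianPi k).prod (gaussianPi m)) (gaussianPi (k + m)) := by
  have hm : Measurable fun p : (Fin k → ℝ) × (Fin m → ℝ) => Fin.append p.1 p.2 := by
    refine measurable_pi_lambda _ fun i => ?_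
    refine Fin.addCases (fun i => ?_) (fun i => ?_) i
    · simp only [Fin.append_left]; fun_prop
    · simp only [Fin.append_right]; fun_prop
  refine ⟨hm, (Measure.pi_eq fun s hs => ?_).symm⟩
  have : (fun p : (Fin k → ℝ) × (Fin m → ℝ) => Fin.append p.1 p.2) ⁻¹' Set.univ.pi s =
      (Set.univ.pi fun i => s (Fin.castAdd m i)) ×ˢ (Set.univ.pi fun i => s (Fin.natAdd k i)) := by
    ext p
    simp only [Set.mem_preimage, Set.mem_pi, Set.mem_univ, true_imp_iff, Set.mem_prod]
    constructor
    · exact fun h => ⟨fun i => by simpa using h (Fin.castAdd m i),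
        fun i => by simpa using h (Fin.natAdd k i)⟩
    · rintro ⟨h1, h2⟩ i
      refine Fin.addCases (fun i => ?_) (fun i => ?_) i
      · simpa using h1 i
      · simpa using h2 i
  rw [Measure.map_apply hm (MeasurableSet.univ_pi hs), this, Measure.prod_prod, Measure.pi_pi,
    Measure.pi_pi, Fin.prod_univ_add]

theorem measurePreserving_neg_rev (k : ℕ) :
    MeasurePreserving (fun (x : Fin k → ℝ) i => -x (Fin.rev i)) (gaussianPi k) (gaussianPi k) := by
  have h1 : MeasurePreserving (fun (x : Fin k → ℝ) i => -x i) (gaussianPi k) (gaussianPi k) :=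
    measurePreserving_pi _ _ fun _ => ⟨measurable_neg, by
      have := gaussianReal_map_neg (μ := 0) (v := 1)
      rwa [neg_zero] at this⟩
  have h2 := measurePreserving_piCongrLeft (fun _ : Fin k => gaussianReal 0 1) Fin.revPerm
  have h3 := h1.comp h2
  convert h3 using 1
  ext x i
  simp only [Function.comp]
  congr 1
  have := MeasurableEquiv.piCongrLeft_apply_apply (β := fun _ : Fin k => ℝ) Fin.revPerm x
    (Fin.rev i)
  simpa using this.symm

/-- The truncated subtraction `j - k` makes the second walk vanish up to time `k`; the first stays
at its final value after time `k`. -/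
theorem W_append {k m : ℕ} (j : ℕ) (x : Fin k → ℝ) (y : Fin m → ℝ) :
    W (k + m) j (WithLp.toLp 2 (Fin.append x y)) =
      W k j (WithLp.toLp 2 x) + W m (j - k) (WithLp.toLp 2 y) := by
  simp only [W_eq_sum_ite, Fin.sum_univ_add, Fin.append_left, Fin.append_right, Fin.val_castAdd,
    Fin.val_natAdd]
  congr 1
  refine Finset.sum_congr rfl fun i _ => ?_
  by_cases h : k + i.val < j
  · rw [if_pos h, if_pos (by omega)]
  · rw [if_neg h, if_neg (by omega)]

theorem W_neg_rev {k j : ℕ} (hj : j ≤ k) (x : Fin k → ℝ) :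
    W k j (WithLp.toLp 2 fun i => -x (Fin.rev i)) =
      W k (k - j) (WithLp.toLp 2 x) - W k k (WithLp.toLp 2 x) := by
  simp only [W_eq_sum_ite, ← Finset.sum_sub_distrib]
  rw [← Equiv.sum_comp Fin.revPerm]
  refine Finset.sum_congr rfl fun i _ => ?_
  have hi := i.isLt
  simp only [Fin.revPerm_apply, Fin.rev_rev, Fin.val_rev, hi, if_true]
  by_cases h : i.val < k - j
  · rw [if_neg (by omega), if_pos h]; ring
  · rw [if_pos (by omega), if_neg h]; ring

theorem W_of_le {n k : ℕ} (h : n ≤ k) (x : EuclideanSpace ℝ (Fin n)) : W n k x = W n n x := by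
  simp only [W_eq_sum_ite]
  refine Finset.sum_congr rfl fun i _ => ?_
  rw [if_pos (by omega), if_pos i.isLt]

theorem append_neg_rev_mem_maxAt_iff {k m : ℕ} (x : Fin k → ℝ) (y : Fin m → ℝ) :
    WithLp.toLp 2 (Fin.append (fun i => -x (Fin.rev i)) y) ∈ maxAt (k + m) k ↔
      WithLp.toLp 2 x ∈ A k ∧ WithLp.toLp 2 y ∈ A m := by
  have hk : W (k + m) k (WithLp.toLp 2 (Fin.append (fun i => -x (Fin.rev i)) y)) =
      - W k k (WithLp.toLp 2 x) := by
    rw [W_append, W_neg_rev le_rfl]; simp [W_zero]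
  have hlow {j : ℕ} (hj : j ≤ k) :
      W (k + m) j (WithLp.toLp 2 (Fin.append (fun i => -x (Fin.rev i)) y)) =
        W k (k - j) (WithLp.toLp 2 x) - W k k (WithLp.toLp 2 x) := by
    rw [W_append, W_neg_rev hj, Nat.sub_eq_zero_of_le hj, W_zero, add_zero]
  have hhigh (j : ℕ) :
      W (k + m) (k + j) (WithLp.toLp 2 (Fin.append (fun i => -x (Fin.rev i)) y)) =
        - W k k (WithLp.toLp 2 x) + W m j (WithLp.toLp 2 y) := by
    rw [W_append, W_of_le (by omega), W_neg_rev le_rfl]; simp [W_zero]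
  simp only [maxAt, A, Set.mem_ofPred_eq, hk]
  constructor
  · refine fun h => ⟨fun j hj => ?_, fun j hj => ?_⟩
    · have := h (k - j) (by omega)
      rw [hlow (by omega), Nat.sub_sub_self hj] at this
      linarith
    · have := h (k + j) (by omega)
      rw [hhigh] at this
      linarith
  · rintro ⟨h1, h2⟩ j hj
    rcases le_total j k with h | h
    · rw [hlow h]
      linarith [h1 (k - j) (by omega)]
    · obtain ⟨i, rfl⟩ := Nat.exists_eq_add_of_le h
      rw [hhigh]
      linarith [h2 i (by omega)]

/-- The two blocks of coordinates are independent, and negating and reversing the first preserves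
its law. -/
theorem measureReal_maxAt (k m : ℕ) :
    (γ (k + m)).real (maxAt (k + m) k) = (γ k).real (A k) * (γ m).real (A m) := by
  have hT := (measurePreserving_toLp (k + m)).comp ((measurePreserving_append k m).comp
    ((measurePreserving_neg_rev k).prod (MeasurePreserving.id (gaussianPi m))))
  have h1 := hT.measureReal_preimage (measurableSet_maxAt (k + m) k).nullMeasurableSet
  have h2 := (measurePreserving_toLp k).measureReal_preimage (measurableSet_A k).nullMeasurableSet
  have h3 := (measurePreserving_toLp m).measureReal_preimage (measurableSet_A m).nullMeasurableSet
  rw [← h1, ← h2, ← h3, ← measureReal_prod_prod]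
  congr 1
  ext p
  simpa using append_neg_rev_mem_maxAt_iff p.1 p.2

theorem gaussian_measureReal_A (n : ℕ) :
    (γ n).real (A n) = (Nat.choose (2 * n) n : ℝ) / 4 ^ n := by
  refine eq_centralBinom_of_sum_antidiagonal_eq_one (p := fun n => (γ n).real (A n)) ?_ ?_ n
  · have : A 0 = Set.univ := by
      ext x; simp [A, W]
    simp [this]
  · intro n
    rw [Finset.Nat.sum_antidiagonal_eq_sum_range_succ_mk]
    rw [← sum_measureReal_eq_one_of_cover (μ := γ n) (Finset.range n.succ) (B := maxAt n)
      (fun i _ => measurableSet_maxAt n i)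
      (fun i hi j hj hij => measure_maxAt_inter_eq_zero (by simp at hi; omega)
        (by simp at hj; omega) hij)
      (Filter.Eventually.of_forall (exists_mem_maxAt n))]
    refine Finset.sum_congr rfl fun k hk => ?_
    obtain ⟨m, rfl⟩ := Nat.exists_eq_add_of_le (Nat.lt_succ_iff.1 (Finset.mem_range.1 hk))
    have h : k + m - k = m := by omega
    change (γ k).real (A k) * (γ (k + m - k)).real (A (k + m - k)) = _
    rw [h]
    exact (measureReal_maxAt k m).symm

/-! ### The Gaussian bridge and its cyclic symmetry -/

/-- The projection `x ↦ x - ⟨e, x⟩ e` along a vector `e`; it is the orthogonal projection onto the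
hyperplane orthogonal to `e` if `e` is a unit vector. -/
def projAlong {n : ℕ} (e x : EuclideanSpace ℝ (Fin n)) : EuclideanSpace ℝ (Fin n) :=
  x - inner ℝ e x • e

theorem continuous_projAlong {n : ℕ} (e : EuclideanSpace ℝ (Fin n)) :
    Continuous (projAlong e) := by
  unfold projAlong; fun_prop

theorem inner_projAlong {n : ℕ} (e v x : EuclideanSpace ℝ (Fin n)) :
    inner ℝ v (projAlong e x) = inner ℝ (projAlong e v) x := by
  simp only [projAlong, inner_sub_left, inner_sub_right, real_inner_smul_left,
    real_inner_smul_right, real_inner_comm v e]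
  ring

theorem inner_self_projAlong {n : ℕ} {e : EuclideanSpace ℝ (Fin n)} (he : ‖e‖ = 1)
    (x : EuclideanSpace ℝ (Fin n)) : inner ℝ e (projAlong e x) = 0 := by
  simp [projAlong, inner_sub_right, real_inner_smul_right, he]

/-- The unit vector in the diagonal direction. -/
def diagonalUnit (n : ℕ) : EuclideanSpace ℝ (Fin n) := (√n)⁻¹ • walkVector n n

theorem norm_walkVector_self (n : ℕ) : ‖walkVector n n‖ = √n := by
  simp [EuclideanSpace.norm_eq, walkVector]

theorem norm_diagonalUnit {n : ℕ} (hn : 1 ≤ n) : ‖diagonalUnit n‖ = 1 := by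
  have : √(n : ℝ) ≠ 0 := by
    have : (0 : ℝ) < n := by exact_mod_cast hn
    positivity
  rw [diagonalUnit, norm_smul, norm_walkVector_self, norm_inv, Real.norm_of_nonneg (by positivity)]
  exact inv_mul_cancel₀ this

theorem diagonalUnit_apply {n : ℕ} (i : Fin n) : diagonalUnit n i = (√n)⁻¹ := by
  simp [diagonalUnit, walkVector]

theorem inner_diagonalUnit {n : ℕ} (x : EuclideanSpace ℝ (Fin n)) :
    inner ℝ (diagonalUnit n) x = (√n)⁻¹ * W n n x := by
  rw [diagonalUnit, real_inner_smul_left, inner_walkVector]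

theorem inner_diagonalUnit_pos_iff {n : ℕ} (hn : 1 ≤ n) (x : EuclideanSpace ℝ (Fin n)) :
    0 < inner ℝ (diagonalUnit n) x ↔ 0 < W n n x := by
  have : (0 : ℝ) < n := by exact_mod_cast hn
  rw [inner_diagonalUnit]
  exact mul_pos_iff_of_pos_left (by positivity)

/-- The law of the standard Gaussian vector conditioned to have sum zero. -/
def bridgeMeasure (n : ℕ) : Measure (EuclideanSpace ℝ (Fin n)) :=
  (γ n).map (projAlong (diagonalUnit n))

instance (n : ℕ) : IsProbabilityMeasure (bridgeMeasure n) :=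
  Measure.isProbabilityMeasure_map (continuous_projAlong _).measurable.aemeasurable

theorem ae_bridgeMeasure_W_eq_zero {n : ℕ} (hn : 1 ≤ n) :
    ∀ᵐ x ∂bridgeMeasure n, W n n x = 0 := by
  rw [bridgeMeasure, ae_map_iff (continuous_projAlong _).measurable.aemeasurable
    (measurableSet_eq_fun (continuous_W n n).measurable measurable_const)]
  refine Filter.Eventually.of_forall fun x => ?_
  have h := inner_self_projAlong (norm_diagonalUnit hn) x
  rw [inner_diagonalUnit] at h
  have : (0 : ℝ) < n := by exact_mod_cast hn
  exact (mul_eq_zero.1 h).resolve_left (by positivity)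

/-- The cyclic shift of coordinates. -/
def cyclicShift (m : ℕ) :
    EuclideanSpace ℝ (Fin (m + 1)) ≃ₗᵢ[ℝ] EuclideanSpace ℝ (Fin (m + 1)) :=
  LinearIsometryEquiv.piLpCongrLeft 2 ℝ ℝ (finRotate (m + 1)).symm

theorem cyclicShift_apply {m : ℕ} (x : EuclideanSpace ℝ (Fin (m + 1))) (i : Fin (m + 1)) :
    cyclicShift m x i = x (finRotate (m + 1) i) := by
  simp [cyclicShift, LinearIsometryEquiv.piLpCongrLeft_apply, Equiv.piCongrLeft']

theorem W_cyclicShift {m k : ℕ} (hk : k ≤ m) (x : EuclideanSpace ℝ (Fin (m + 1))) :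
    W (m + 1) k (cyclicShift m x) = W (m + 1) (k + 1) x - W (m + 1) 1 x := by
  simp only [W_eq_sum_ite, cyclicShift_apply, ← Finset.sum_sub_distrib]
  rw [← Equiv.sum_comp (finRotate (m + 1)) fun i : Fin (m + 1) =>
    (if i.val < k + 1 then x i else 0) - if i.val < 1 then x i else 0]
  refine Finset.sum_congr rfl fun i _ => ?_
  rcases Fin.eq_castSucc_or_eq_last i with ⟨j, rfl⟩ | rfl
  · simp
  · simp [hk]

theorem W_cyclicShift_self {m : ℕ} (x : EuclideanSpace ℝ (Fin (m + 1))) :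
    W (m + 1) (m + 1) (cyclicShift m x) = W (m + 1) (m + 1) x := by
  simp only [W_eq_sum_ite, cyclicShift_apply, Fin.is_lt, if_true]
  exact Equiv.sum_comp (finRotate (m + 1)) fun i => x i

/-- The diagonal is fixed by every permutation of coordinates; this carries the invariance of `γ`
over to the bridge. -/
theorem cyclicShift_projAlong {m : ℕ} (x : EuclideanSpace ℝ (Fin (m + 1))) :
    cyclicShift m (projAlong (diagonalUnit (m + 1)) x) =
      projAlong (diagonalUnit (m + 1)) (cyclicShift m x) := by
  ext i
  simp [projAlong, cyclicShift_apply, diagonalUnit_apply, inner_diagonalUnit, W_cyclicShift_self]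

theorem measurePreserving_cyclicShift (m : ℕ) :
    MeasurePreserving (cyclicShift m) (bridgeMeasure (m + 1)) (bridgeMeasure (m + 1)) := by
  refine ⟨(cyclicShift m).continuous.measurable, ?_⟩
  have h : (γ (m + 1)).map (cyclicShift m) = γ (m + 1) := stdGaussian_map (cyclicShift m)
  have hp := (continuous_projAlong (diagonalUnit (m + 1))).measurable
  have hs := (cyclicShift m).continuous.measurable
  conv_rhs => rw [bridgeMeasure, ← h, Measure.map_map hp hs]
  rw [bridgeMeasure, Measure.map_map hs hp]
  congr 1
  ext1 x
  exact cyclicShift_projAlong x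

/-- A closed path extends periodically, and the shift only moves its origin. Times `0` and `m + 1`
have the same height, which settles the index that wraps around. -/
theorem cyclicShift_mem_maxAt_iff {m j : ℕ} (hj : j ≤ m) {x : EuclideanSpace ℝ (Fin (m + 1))}
    (hx : W (m + 1) (m + 1) x = 0) :
    cyclicShift m x ∈ maxAt (m + 1) j ↔ x ∈ maxAt (m + 1) (j + 1) := by
  simp only [maxAt, Set.mem_ofPred_eq]
  constructor
  · intro h k hk
    rcases k with _ | k
    · have := h m (by omega)
      rw [W_cyclicShift le_rfl, W_cyclicShift hj, hx] at this
      rw [W_zero]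
      linarith
    · have := h k (by omega)
      rw [W_cyclicShift (by omega), W_cyclicShift hj] at this
      linarith
  · intro h k hk
    rcases Nat.lt_or_ge m k with hk' | hk'
    · obtain rfl : k = m + 1 := by omega
      rw [W_cyclicShift_self, hx, W_cyclicShift hj]
      linarith [h 1 (by omega)]
    · rw [W_cyclicShift hk', W_cyclicShift hj]
      linarith [h (k + 1) (by omega)]

theorem bridgeMeasure_maxAt {m j : ℕ} (hj : j ≤ m + 1) :
    (bridgeMeasure (m + 1)).real (maxAt (m + 1) j) =
      (bridgeMeasure (m + 1)).real (A (m + 1)) := by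
  induction j with
  | zero => rw [maxAt_zero]
  | succ j ih =>
    rw [← ih (by omega), ← (measurePreserving_cyclicShift m).measureReal_preimage
      (measurableSet_maxAt (m + 1) j).nullMeasurableSet]
    refine measureReal_congr ?_
    filter_upwards [ae_bridgeMeasure_W_eq_zero (n := m + 1) (by omega)] with x hx
    exact propext (cyclicShift_mem_maxAt_iff (by omega) hx).symm

/-- The difference has last coordinate `0` and `i`-th coordinate `1`, so it is not diagonal. The
bound `j ≤ m` matters: times `0` and `m + 1` always tie on the bridge. -/
theorem projAlong_walkVector_sub_ne_zero {m i j : ℕ} (hij : i < j) (hj : j ≤ m) :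
    projAlong (diagonalUnit (m + 1)) (walkVector (m + 1) j - walkVector (m + 1) i) ≠ 0 := by
  intro h
  rw [projAlong, sub_eq_zero] at h
  have h1 := congrArg (fun v : EuclideanSpace ℝ (Fin (m + 1)) => v (Fin.last m)) h
  have h2 := congrArg (fun v : EuclideanSpace ℝ (Fin (m + 1)) => v ⟨i, by omega⟩) h
  simp only [PiLp.smul_apply, diagonalUnit_apply] at h1 h2
  rw [← h1] at h2
  simp [walkVector, hij, not_lt.2 hj, not_lt.2 (hij.le.trans hj)] at h2

theorem bridgeMeasure_maxAt_inter_eq_zero {m i j : ℕ} (hi : i ≤ m) (hj : j ≤ m) (hij : i ≠ j) :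
    bridgeMeasure (m + 1) (maxAt (m + 1) i ∩ maxAt (m + 1) j) = 0 := by
  wlog h : i < j generalizing i j
  · rw [Set.inter_comm]
    exact this hj hi hij.symm (by omega)
  rw [bridgeMeasure, Measure.map_apply (continuous_projAlong _).measurable
    ((measurableSet_maxAt _ _).inter (measurableSet_maxAt _ _))]
  refine measure_mono_null ?_ (stdGaussian_inner_eq_zero (projAlong_walkVector_sub_ne_zero h hj))
  rintro x ⟨h1, h2⟩
  rw [Set.mem_ofPred_eq, ← inner_projAlong, inner_sub_left, inner_walkVector, inner_walkVector]
  linarith [h1 j (by omega), h2 i (by omega)]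

theorem bridgeMeasure_measureReal_A {n : ℕ} (hn : 1 ≤ n) :
    (bridgeMeasure n).real (A n) = 1 / n := by
  obtain ⟨m, rfl⟩ : ∃ m, n = m + 1 := ⟨n - 1, by omega⟩
  have h := sum_measureReal_eq_one_of_cover (μ := bridgeMeasure (m + 1)) (Finset.range (m + 1))
    (B := maxAt (m + 1)) (fun i _ => measurableSet_maxAt _ i)
    (fun i hi j hj hij => bridgeMeasure_maxAt_inter_eq_zero (by simp at hi; omega)
        (by simp at hj; omega) hij) (by
      filter_upwards [ae_bridgeMeasure_W_eq_zero hn] with x hx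
      obtain ⟨j, hj, h⟩ := exists_mem_maxAt (m + 1) x
      rcases Nat.lt_or_ge j (m + 1) with h' | h'
      · exact ⟨j, by simpa using h', h⟩
      -- A maximum at the final time is also one at time `0`, so `m + 1` times suffice for the
      -- cover.
      · refine ⟨0, by simp, fun k hk => ?_⟩
        have := h k hk
        rwa [W_of_le h', hx, ← W_zero (m + 1) x] at this)
  rw [Finset.sum_congr rfl fun j hj => bridgeMeasure_maxAt (Finset.mem_range.1 hj).le] at h
  rw [Finset.sum_const, Finset.card_range, nsmul_eq_mul] at h
  rw [eq_div_iff (by positivity), mul_comm]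
  exact h

/-! ### Uniqueness of the measure-derivative -/

variable {n : ℕ}

theorem isTestFunction_comp_inner {f : ℝ → ℝ} (hf : ContDiff ℝ (⊤ : ℕ∞) f)
    (hb : ∀ k x, |iteratedDeriv k f x| ≤ 1) (t : EuclideanSpace ℝ (Fin n)) :
    IsTestFunction fun x => f (inner ℝ x t) := by
  have he : (fun x => f (inner ℝ x t)) = f ∘ innerSL ℝ t := by
    ext x
    simp [real_inner_comm]
  rw [he]
  refine ⟨hf.comp (innerSL ℝ t).contDiff, fun k => ⟨∏ _i : Fin k, ‖innerSL ℝ t‖, fun x => ?_⟩⟩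
  rw [(innerSL ℝ t).iteratedFDeriv_comp_right hf x (by exact_mod_cast le_top)]
  refine (ContinuousMultilinearMap.norm_compContinuousLinearMap_le _ _).trans ?_
  rw [norm_iteratedFDeriv_eq_norm_iteratedDeriv]
  exact mul_le_of_le_one_left (by positivity) (hb k _)

theorem IsTestFunction.exists_bound {g : EuclideanSpace ℝ (Fin n) → ℝ} (hg : IsTestFunction g) :
    ∃ C, ∀ x, ‖g x‖ ≤ C := by
  simpa using hg.bounded 0

theorem IsTestFunction.exists_fderiv_bound {g : EuclideanSpace ℝ (Fin n) → ℝ}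
    (hg : IsTestFunction g) : ∃ C, ∀ x, ‖fderiv ℝ g x‖ ≤ C := by
  simpa only [norm_iteratedFDeriv_one] using hg.bounded 1

theorem IsTestFunction.integrable {g : EuclideanSpace ℝ (Fin n) → ℝ} (hg : IsTestFunction g)
    (μ : Measure (EuclideanSpace ℝ (Fin n))) [IsFiniteMeasure μ] : Integrable g μ := by
  obtain ⟨C, hC⟩ := hg.exists_bound
  exact .of_bound hg.contDiff.continuous.aestronglyMeasurable C (.of_forall hC)

theorem vectorIntegral_toSignedMeasure {X : Type*} [MeasurableSpace X] (μ : Measure X)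
    [IsFiniteMeasure μ] (f : X → ℝ) : ∫ᵛ x, f x ∂•μ.toSignedMeasure = ∫ x, f x ∂μ := by
  have : (ContinuousLinearMap.lsmul ℝ ℝ : ℝ →L[ℝ] ℝ →L[ℝ] ℝ) =
      (ContinuousLinearMap.lsmul ℝ ℝ : ℝ →L[ℝ] ℝ →L[ℝ] ℝ).flip := by
    ext; simp
  rw [this]
  exact VectorMeasure.integral_toSignedMeasure

theorem vectorIntegral_signedMeasure {X : Type*} [MeasurableSpace X] (s : SignedMeasure X)
    {f : X → ℝ} (h1 : Integrable f s.toJordanDecomposition.posPart)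
    (h2 : Integrable f s.toJordanDecomposition.negPart) :
    ∫ᵛ x, f x ∂•s = ∫ x, f x ∂s.toJordanDecomposition.posPart -
      ∫ x, f x ∂s.toJordanDecomposition.negPart := by
  conv_lhs => rw [← s.toSignedMeasure_toJordanDecomposition, JordanDecomposition.toSignedMeasure]
  rw [VectorMeasure.integral_sub_vectorMeasure, vectorIntegral_toSignedMeasure,
    vectorIntegral_toSignedMeasure]
  · simpa [VectorMeasure.Integrable] using h1
  · simpa [VectorMeasure.Integrable] using h2

/-- The real and imaginary parts of the characteristic function are integrals of the test functions
`cos ⟨x, t⟩` and `sin ⟨x, t⟩`. -/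
theorem measure_ext_of_testFunction {μ ν : Measure (EuclideanSpace ℝ (Fin n))}
    [IsFiniteMeasure μ] [IsFiniteMeasure ν]
    (h : ∀ g, IsTestFunction g → ∫ x, g x ∂μ = ∫ x, g x ∂ν) : μ = ν := by
  refine Measure.ext_of_charFun (funext fun t => ?_)
  have hcos := isTestFunction_comp_inner Real.contDiff_cos Real.abs_iteratedDeriv_cos_le_one t
  have hsin := isTestFunction_comp_inner Real.contDiff_sin Real.abs_iteratedDeriv_sin_le_one t
  have key (ρ : Measure (EuclideanSpace ℝ (Fin n))) [IsFiniteMeasure ρ] :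
      charFun ρ t = ((∫ x, Real.cos (inner ℝ x t) ∂ρ : ℝ) : ℂ) +
        ((∫ x, Real.sin (inner ℝ x t) ∂ρ : ℝ) : ℂ) * Complex.I := by
    rw [charFun_apply, ← integral_complex_ofReal, ← integral_complex_ofReal,
      ← integral_mul_const, ← integral_add (hcos.integrable ρ).ofReal
        ((hsin.integrable ρ).ofReal.mul_const _)]
    refine integral_congr_ae (.of_forall fun x => ?_)
    simp [Complex.exp_mul_I]
  rw [key, key, h _ hcos, h _ hsin]

theorem signedMeasure_ext_of_testFunction {s t : SignedMeasure (EuclideanSpace ℝ (Fin n))}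
    (h : ∀ g : EuclideanSpace ℝ (Fin n) → ℝ, IsTestFunction g →
      ∫ᵛ x, g x ∂•s = ∫ᵛ x, g x ∂•t) : s = t := by
  -- Moving the negative parts across turns an equality of signed measures into one of positive
  -- finite measures.
  have hm : s.toJordanDecomposition.posPart + t.toJordanDecomposition.negPart =
      t.toJordanDecomposition.posPart + s.toJordanDecomposition.negPart := by
    refine measure_ext_of_testFunction fun g hg => ?_
    have := h g hg
    rw [vectorIntegral_signedMeasure s (hg.integrable _) (hg.integrable _),
      vectorIntegral_signedMeasure t (hg.integrable _) (hg.integrable _)] at this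
    rw [integral_add_measure (hg.integrable _) (hg.integrable _),
      integral_add_measure (hg.integrable _) (hg.integrable _)]
    linarith
  rw [← s.toSignedMeasure_toJordanDecomposition, ← t.toSignedMeasure_toJordanDecomposition,
    JordanDecomposition.toSignedMeasure, JordanDecomposition.toSignedMeasure]
  have h2 := Measure.toSignedMeasure_congr hm
  rw [Measure.toSignedMeasure_add, Measure.toSignedMeasure_add] at h2
  rw [sub_eq_sub_iff_add_eq_add]
  exact h2

theorem component_apply
    (D : VectorMeasure (EuclideanSpace ℝ (Fin n)) (EuclideanSpace ℝ (Fin n)))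
    (h : EuclideanSpace ℝ (Fin n)) (s : Set (EuclideanSpace ℝ (Fin n))) :
    component D h s = inner ℝ h (D s) := rfl

theorem IsMeasureDeriv.unique {u : EuclideanSpace ℝ (Fin n) → ℝ}
    {D D' : VectorMeasure (EuclideanSpace ℝ (Fin n)) (EuclideanSpace ℝ (Fin n))}
    (hD : IsMeasureDeriv u D) (hD' : IsMeasureDeriv u D') : D = D' := by
  ext1 s hs
  refine ext_inner_left ℝ fun h => ?_
  have hc : component D h = component D' h :=
    signedMeasure_ext_of_testFunction fun g hg => by
      rw [hD.integral_eq h g hg, hD'.integral_eq h g hg]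
  have := congrArg (fun v : SignedMeasure (EuclideanSpace ℝ (Fin n)) => v s) hc
  simpa only [component_apply] using this

theorem measureDeriv_eq {u : EuclideanSpace ℝ (Fin n) → ℝ}
    {D : VectorMeasure (EuclideanSpace ℝ (Fin n)) (EuclideanSpace ℝ (Fin n))}
    (hD : IsMeasureDeriv u D) : measureDeriv u = D := by
  have hu : ∃ D, IsMeasureDeriv u D := ⟨D, hD⟩
  rw [measureDeriv, dif_pos hu]
  exact hu.choose_spec.unique hD

/-! ### Vector measures of constant direction -/

/-- The vector measure `e • ν` with constant direction `e`. -/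
def directedMeasure (ν : Measure (EuclideanSpace ℝ (Fin n))) [IsFiniteMeasure ν]
    (e : EuclideanSpace ℝ (Fin n)) :
    VectorMeasure (EuclideanSpace ℝ (Fin n)) (EuclideanSpace ℝ (Fin n)) :=
  ν.toSignedMeasure.mapRange (ContinuousLinearMap.toSpanSingleton ℝ e : ℝ →+ _)
    (ContinuousLinearMap.toSpanSingleton ℝ e).continuous

theorem directedMeasure_apply (ν : Measure (EuclideanSpace ℝ (Fin n))) [IsFiniteMeasure ν]
    (e : EuclideanSpace ℝ (Fin n)) {s : Set (EuclideanSpace ℝ (Fin n))} (hs : MeasurableSet s) :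
    directedMeasure ν e s = ν.real s • e := by
  rw [← Measure.toSignedMeasure_apply_measurable hs]
  rfl

theorem variation_directedMeasure (ν : Measure (EuclideanSpace ℝ (Fin n))) [IsFiniteMeasure ν]
    {e : EuclideanSpace ℝ (Fin n)} (he : ‖e‖ = 1) : (directedMeasure ν e).variation = ν := by
  have key {s : Set (EuclideanSpace ℝ (Fin n))} (hs : MeasurableSet s) :
      ‖directedMeasure ν e s‖ₑ = ν s := by
    rw [directedMeasure_apply ν e hs, ← ofReal_norm, norm_smul, he, mul_one,
      Real.norm_of_nonneg measureReal_nonneg, ofReal_measureReal]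
  refine le_antisymm (VectorMeasure.variation_le_of_forall_enorm_le fun s hs => (key hs).le) ?_
  exact Measure.le_iff.2 fun s hs =>
    (key hs).symm.le.trans (VectorMeasure.enorm_measure_le_variation _ _)

theorem component_directedMeasure (ν : Measure (EuclideanSpace ℝ (Fin n))) [IsFiniteMeasure ν]
    (e h : EuclideanSpace ℝ (Fin n)) :
    component (directedMeasure ν e) h = inner ℝ e h • ν.toSignedMeasure := by
  ext s hs
  rw [component_apply, directedMeasure_apply ν e hs, real_inner_smul_right, mul_comm,
    real_inner_comm, _root_.smul_apply, Measure.toSignedMeasure_apply_measurable hs,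
    smul_eq_mul]

/-! ### Gaussian integration by parts in one dimension -/

theorem hasDerivAt_gaussianPDFReal (t : ℝ) :
    HasDerivAt (gaussianPDFReal 0 1) (-t * gaussianPDFReal 0 1 t) t := by
  have h : HasDerivAt (fun x : ℝ => -(x - 0) ^ 2 / (2 * ((1 : NNReal) : ℝ))) (-t) t := by
    have := (((hasDerivAt_id t).sub_const 0).pow 2).neg.div_const (2 * ((1 : NNReal) : ℝ))
    refine this.congr_deriv ?_
    norm_num
    ring
  have h2 := h.exp.const_mul (√(2 * Real.pi * ((1 : NNReal) : ℝ)))⁻¹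
  rw [gaussianPDFReal_def]
  refine h2.congr_deriv ?_
  ring

theorem tendsto_gaussianPDFReal_cocompact :
    Filter.Tendsto (gaussianPDFReal 0 1) (Filter.cocompact ℝ) (nhds 0) := by
  have := tendsto_rpow_abs_mul_exp_neg_mul_sq_cocompact (a := 1 / 2) (by norm_num) 0
  have h2 := this.const_mul (√(2 * Real.pi * ((1 : NNReal) : ℝ)))⁻¹
  rw [mul_zero] at h2
  refine h2.congr fun x => ?_
  rw [gaussianPDFReal_def, Real.rpow_zero, one_mul]
  congr 2
  simp
  ring

section OneDim

variable {F F' : ℝ → ℝ} {C C' : ℝ}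

theorem integrable_gaussian_stein (hF : ∀ t, HasDerivAt F (F' t) t) (hF' : Continuous F')
    (hC : ∀ t, ‖F t‖ ≤ C) (hC' : ∀ t, ‖F' t‖ ≤ C') :
    Integrable (fun t => F' t - F t * t) (gaussianReal 0 1) := by
  have hc : Continuous F := continuous_iff_continuousAt.2 fun t => (hF t).continuousAt
  exact (Integrable.of_bound hF'.aestronglyMeasurable C' (.of_forall hC')).sub
    (Integrable.bdd_mul (IsGaussian.integrable_id (μ := gaussianReal 0 1))
      hc.aestronglyMeasurable (.of_forall hC))

theorem integrable_pdf_mul_stein (hF : ∀ t, HasDerivAt F (F' t) t) (hF' : Continuous F')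
    (hC : ∀ t, ‖F t‖ ≤ C) (hC' : ∀ t, ‖F' t‖ ≤ C') :
    Integrable (fun t => gaussianPDFReal 0 1 t * (F' t - F t * t)) := by
  have h := integrable_gaussian_stein hF hF' hC hC'
  rw [gaussianReal_of_var_ne_zero 0 one_ne_zero, integrable_withDensity_iff_integrable_smul'
    (measurable_gaussianPDF 0 1) (.of_forall fun _ => gaussianPDF_lt_top)] at h
  simpa [toReal_gaussianPDF] using h

/-- Since the density satisfies `φ' = -tφ`, the weighted integrand `F' - tF` is an exact derivative,
and only boundary values of `φF` remain. -/
theorem hasDerivAt_pdf_mul (hF : ∀ t, HasDerivAt F (F' t) t) (t : ℝ) :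
    HasDerivAt (fun t => gaussianPDFReal 0 1 t * F t)
      (gaussianPDFReal 0 1 t * (F' t - F t * t)) t := by
  refine ((hasDerivAt_gaussianPDFReal t).mul (hF t)).congr_deriv ?_
  ring

theorem tendsto_pdf_mul_cocompact (hC : ∀ t, ‖F t‖ ≤ C) :
    Filter.Tendsto (fun t => gaussianPDFReal 0 1 t * F t) (Filter.cocompact ℝ) (nhds 0) :=
  tendsto_gaussianPDFReal_cocompact.zero_mul_isBoundedUnder_le
    (Filter.isBoundedUnder_of ⟨C, hC⟩)

/-- Gaussian integration by parts on the line. -/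
theorem integral_gaussian_stein (hF : ∀ t, HasDerivAt F (F' t) t) (hF' : Continuous F')
    (hC : ∀ t, ‖F t‖ ≤ C) (hC' : ∀ t, ‖F' t‖ ≤ C') :
    ∫ t, (F' t - F t * t) ∂gaussianReal 0 1 = 0 := by
  rw [integral_gaussianReal_eq_integral_smul one_ne_zero]
  simp only [smul_eq_mul]
  rw [integral_of_hasDerivAt_of_tendsto (hasDerivAt_pdf_mul hF)
    (integrable_pdf_mul_stein hF hF' hC hC')
    ((tendsto_pdf_mul_cocompact hC).mono_left atBot_le_cocompact)
    ((tendsto_pdf_mul_cocompact hC).mono_left atTop_le_cocompact), sub_zero]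

/-- Gaussian integration by parts on the half-line. -/
theorem integral_indicator_gaussian_stein (hF : ∀ t, HasDerivAt F (F' t) t) (hF' : Continuous F')
    (hC : ∀ t, ‖F t‖ ≤ C) (hC' : ∀ t, ‖F' t‖ ≤ C') :
    ∫ t, (Set.Ioi (0 : ℝ)).indicator (fun _ => (1 : ℝ)) t * (F' t - F t * t) ∂gaussianReal 0 1 =
      -(gaussianPDFReal 0 1 0 * F 0) := by
  rw [integral_gaussianReal_eq_integral_smul one_ne_zero]
  have h (t : ℝ) : gaussianPDFReal 0 1 t •
      ((Set.Ioi (0 : ℝ)).indicator (fun _ => (1 : ℝ)) t * (F' t - F t * t)) =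
      (Set.Ioi (0 : ℝ)).indicator (fun t => gaussianPDFReal 0 1 t * (F' t - F t * t)) t := by
    by_cases ht : t ∈ Set.Ioi (0 : ℝ) <;> simp [ht]
  simp only [h]
  rw [integral_indicator measurableSet_Ioi, integral_Ioi_of_hasDerivAt_of_tendsto'
    (fun t _ => hasDerivAt_pdf_mul hF t) (integrable_pdf_mul_stein hF hF' hC hC').integrableOn
    ((tendsto_pdf_mul_cocompact hC).mono_left atTop_le_cocompact), zero_sub]

end OneDim

/-! ### The measure-derivative of a half-space -/

theorem norm_projAlong_sq {v : EuclideanSpace ℝ (Fin n)} (hv : ‖v‖ = 1)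
    (t : EuclideanSpace ℝ (Fin n)) : ‖projAlong v t‖ ^ 2 = ‖t‖ ^ 2 - inner ℝ v t ^ 2 := by
  rw [projAlong, norm_sub_sq_real, real_inner_smul_right, norm_smul, hv, real_inner_comm]
  simp
  ring

/-- A standard Gaussian vector splits along a unit vector `v` into independent components. -/
theorem map_projAlong_add_smul {v : EuclideanSpace ℝ (Fin n)} (hv : ‖v‖ = 1) :
    ((γ n).prod (gaussianReal 0 1)).map (fun p => projAlong v p.1 + p.2 • v) = γ n := by
  have hm : Measurable fun p : EuclideanSpace ℝ (Fin n) × ℝ => projAlong v p.1 + p.2 • v := by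
    have := (continuous_projAlong v).measurable
    fun_prop
  have := Measure.isProbabilityMeasure_map (μ := (γ n).prod (gaussianReal 0 1)) hm.aemeasurable
  refine Measure.ext_of_charFun (funext fun t => ?_)
  rw [charFun_apply, integral_map hm.aemeasurable (by fun_prop), charFun_stdGaussian]
  have h (p : EuclideanSpace ℝ (Fin n) × ℝ) :
      Complex.exp ((inner ℝ (projAlong v p.1 + p.2 • v) t : ℝ) * Complex.I) =
        Complex.exp ((inner ℝ p.1 (projAlong v t) : ℝ) * Complex.I) *
        Complex.exp ((inner ℝ v t : ℝ) * (p.2 : ℂ) * Complex.I) := by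
    rw [inner_add_left, real_inner_smul_left, real_inner_comm t (projAlong v p.1),
      inner_projAlong, real_inner_comm p.1, ← Complex.exp_add]
    congr 1
    push_cast
    ring
  simp only [h]
  rw [integral_prod_mul (fun x => Complex.exp ((inner ℝ x (projAlong v t) : ℝ) * Complex.I))
    (fun y : ℝ => Complex.exp ((inner ℝ v t : ℝ) * (y : ℂ) * Complex.I)), ← charFun_apply,
    ← charFun_apply_real, charFun_stdGaussian, charFun_gaussianReal, ← Complex.exp_add]
  congr 1
  -- By Pythagoras the two Gaussian exponents add up to `-‖t‖² / 2`.
  rw [← Complex.ofReal_pow ‖projAlong v t‖, norm_projAlong_sq hv]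
  push_cast
  ring

theorem integral_eq_integral_integral_projAlong {v : EuclideanSpace ℝ (Fin n)} (hv : ‖v‖ = 1)
    {f : EuclideanSpace ℝ (Fin n) → ℝ} (hf : Integrable f (γ n)) :
    ∫ x, f x ∂γ n = ∫ x, ∫ t, f (projAlong v x + t • v) ∂gaussianReal 0 1 ∂γ n := by
  have hm : Measurable fun p : EuclideanSpace ℝ (Fin n) × ℝ => projAlong v p.1 + p.2 • v := by
    have := (continuous_projAlong v).measurable
    fun_prop
  have h := map_projAlong_add_smul hv
  conv_lhs => rw [← h]
  rw [← h] at hf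
  rw [integral_map hm.aemeasurable hf.aestronglyMeasurable]
  exact integral_prod _ (hf.comp_measurable hm)

section TestFunction

variable {g : EuclideanSpace ℝ (Fin n) → ℝ} {e v : EuclideanSpace ℝ (Fin n)}

/-- The open half-space of vectors with positive scalar product with `e`. -/
def halfSpace (e : EuclideanSpace ℝ (Fin n)) : Set (EuclideanSpace ℝ (Fin n)) :=
  {x | 0 < inner ℝ e x}

theorem measurableSet_halfSpace (e : EuclideanSpace ℝ (Fin n)) : MeasurableSet (halfSpace e) :=
  measurableSet_lt measurable_const (by fun_prop)

theorem integrable_indicator_mul_adjDeriv (hg : IsTestFunction g)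
    {s : Set (EuclideanSpace ℝ (Fin n))} (hs : MeasurableSet s) (v : EuclideanSpace ℝ (Fin n)) :
    Integrable (fun x => s.indicator (fun _ => (1 : ℝ)) x * adjDeriv v g x) (γ n) := by
  obtain ⟨C, hC⟩ := hg.exists_bound
  obtain ⟨C', hC'⟩ := hg.exists_fderiv_bound
  have hd : Continuous fun x => fderiv ℝ g x v :=
    (hg.contDiff.continuous_fderiv (by simp)).clm_apply continuous_const
  have h1 : Integrable (fun x => fderiv ℝ g x v) (γ n) :=
    .of_bound hd.aestronglyMeasurable (C' * ‖v‖) (.of_forall fun x =>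
      ((fderiv ℝ g x).le_opNorm v).trans (by gcongr; exact hC' x))
  have h2 : Integrable (fun x : EuclideanSpace ℝ (Fin n) => inner ℝ v x) (γ n) :=
    (innerSL ℝ v).integrable_comp IsGaussian.integrable_id
  have h3 : Integrable (fun x => g x * inner ℝ v x) (γ n) :=
    h2.bdd_mul hg.contDiff.continuous.aestronglyMeasurable (.of_forall hC)
  refine (h1.sub h3).bdd_mul (c := 1)
    ((measurable_const.indicator hs).aestronglyMeasurable) (.of_forall fun x => ?_)
  by_cases hx : x ∈ s <;> simp [hx]

theorem hasDerivAt_comp_line (hg : IsTestFunction g) (y v : EuclideanSpace ℝ (Fin n)) (t : ℝ) :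
    HasDerivAt (fun t : ℝ => g (y + t • v)) (fderiv ℝ g (y + t • v) v) t := by
  have h1 : HasFDerivAt g (fderiv ℝ g (y + t • v)) (y + t • v) :=
    (hg.contDiff.differentiable (by simp) _).hasFDerivAt
  have h2 : HasDerivAt (fun t : ℝ => y + t • v) v t := by
    simpa using ((hasDerivAt_id t).smul_const v).const_add y
  exact h1.comp_hasDerivAt t h2

theorem continuous_fderiv_comp_line (hg : IsTestFunction g) (y v : EuclideanSpace ℝ (Fin n)) :
    Continuous fun t : ℝ => fderiv ℝ g (y + t • v) v :=
  ((hg.contDiff.continuous_fderiv (by simp)).comp (by fun_prop)).clm_apply continuous_const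

theorem adjDeriv_line (hv : ‖v‖ = 1) (x : EuclideanSpace ℝ (Fin n)) (t : ℝ) :
    adjDeriv v g (projAlong v x + t • v) =
      fderiv ℝ g (projAlong v x + t • v) v - g (projAlong v x + t • v) * t := by
  rw [adjDeriv, inner_add_right, inner_self_projAlong hv, real_inner_smul_right,
    real_inner_self_eq_norm_sq, hv]
  simp

theorem inner_line_self (hv : ‖v‖ = 1) (x : EuclideanSpace ℝ (Fin n)) (t : ℝ) :
    inner ℝ v (projAlong v x + t • v) = t := by
  rw [inner_add_right, inner_self_projAlong hv, real_inner_smul_right,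
    real_inner_self_eq_norm_sq, hv]
  simp

/-- Each line parallel to `e` meets the half-space in the half-line `t > 0`, whose boundary term
sits at the projection of the line to the hyperplane. -/
theorem integral_halfSpace_adjDeriv_self (hg : IsTestFunction g) (he : ‖e‖ = 1) :
    ∫ x, (halfSpace e).indicator (fun _ => (1 : ℝ)) x * adjDeriv e g x ∂γ n =
      -(gaussianPDFReal 0 1 0 * ∫ x, g (projAlong e x) ∂γ n) := by
  obtain ⟨C, hC⟩ := hg.exists_bound
  obtain ⟨C', hC'⟩ := hg.exists_fderiv_bound
  rw [integral_eq_integral_integral_projAlong he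
    (integrable_indicator_mul_adjDeriv hg (measurableSet_halfSpace e) e),
    ← integral_const_mul, ← integral_neg]
  congr 1
  ext x
  have h := integral_indicator_gaussian_stein (hasDerivAt_comp_line hg (projAlong e x) e)
    (continuous_fderiv_comp_line hg (projAlong e x) e) (fun t => hC _)
    (fun t => ((fderiv ℝ g _).le_opNorm e).trans (by rw [he, mul_one]; exact hC' _))
  simp only [zero_smul, add_zero] at h
  rw [← h]
  congr 1
  ext t
  rw [adjDeriv_line he]
  congr 1
  simp [Set.indicator, halfSpace, inner_line_self he]

/-- The indicator is constant on lines parallel to `v`, and integration by parts over a full line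
leaves no boundary term. -/
theorem integral_halfSpace_adjDeriv_of_orthogonal (hg : IsTestFunction g)
    (hv : ‖v‖ = 1) (hev : inner ℝ e v = 0) :
    ∫ x, (halfSpace e).indicator (fun _ => (1 : ℝ)) x * adjDeriv v g x ∂γ n = 0 := by
  obtain ⟨C, hC⟩ := hg.exists_bound
  obtain ⟨C', hC'⟩ := hg.exists_fderiv_bound
  rw [integral_eq_integral_integral_projAlong hv
    (integrable_indicator_mul_adjDeriv hg (measurableSet_halfSpace e) v)]
  refine integral_eq_zero_of_ae (.of_forall fun x => ?_)
  have h := integral_gaussian_stein (hasDerivAt_comp_line hg (projAlong v x) v)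
    (continuous_fderiv_comp_line hg (projAlong v x) v) (fun t => hC _)
    (fun t => ((fderiv ℝ g _).le_opNorm v).trans (by rw [hv, mul_one]; exact hC' _))
  have hx (t : ℝ) : (halfSpace e).indicator (fun _ => (1 : ℝ)) (projAlong v x + t • v) =
      (halfSpace e).indicator (fun _ => (1 : ℝ)) x := by
    have hmem : projAlong v x + t • v ∈ halfSpace e ↔ x ∈ halfSpace e := by
      simp [halfSpace, inner_add_right, real_inner_smul_right, hev, projAlong, inner_sub_right]
    by_cases h : x ∈ halfSpace e <;> simp [hmem, h]
  simp only [hx, adjDeriv_line hv, integral_const_mul, h, mul_zero, Pi.zero_apply]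

theorem adjDeriv_add (h h' : EuclideanSpace ℝ (Fin n)) (g : EuclideanSpace ℝ (Fin n) → ℝ)
    (x : EuclideanSpace ℝ (Fin n)) : adjDeriv (h + h') g x = adjDeriv h g x + adjDeriv h' g x := by
  simp only [adjDeriv, map_add, inner_add_left]
  ring

theorem adjDeriv_smul (c : ℝ) (h : EuclideanSpace ℝ (Fin n)) (g : EuclideanSpace ℝ (Fin n) → ℝ)
    (x : EuclideanSpace ℝ (Fin n)) : adjDeriv (c • h) g x = c * adjDeriv h g x := by
  simp only [adjDeriv, map_smul, real_inner_smul_left, smul_eq_mul]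
  ring

theorem integral_halfSpace_adjDeriv_projAlong (hg : IsTestFunction g) (he : ‖e‖ = 1)
    (h : EuclideanSpace ℝ (Fin n)) :
    ∫ x, (halfSpace e).indicator (fun _ => (1 : ℝ)) x * adjDeriv (projAlong e h) g x ∂γ n = 0 := by
  by_cases h0 : projAlong e h = 0
  · simp [h0, adjDeriv]
  · have h1 : projAlong e h = ‖projAlong e h‖ • ((‖projAlong e h‖)⁻¹ • projAlong e h) := by
      rw [smul_smul, mul_inv_cancel₀ (norm_ne_zero_iff.2 h0), one_smul]
    have h2 : ‖(‖projAlong e h‖)⁻¹ • projAlong e h‖ = 1 := norm_smul_inv_norm (𝕜 := ℝ) h0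
    rw [h1]
    simp only [adjDeriv_smul ‖projAlong e h‖, mul_left_comm _ ‖projAlong e h‖]
    rw [integral_const_mul, integral_halfSpace_adjDeriv_of_orthogonal hg h2 (by
        rw [real_inner_smul_right, inner_self_projAlong he, mul_zero]), mul_zero]

theorem integral_halfSpace_adjDeriv (hg : IsTestFunction g) (he : ‖e‖ = 1)
    (h : EuclideanSpace ℝ (Fin n)) :
    ∫ x, (halfSpace e).indicator (fun _ => (1 : ℝ)) x * adjDeriv h g x ∂γ n =
      -(inner ℝ e h * (gaussianPDFReal 0 1 0 * ∫ x, g (projAlong e x) ∂γ n)) := by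
  have hd : h = inner ℝ e h • e + projAlong e h := by simp [projAlong]
  have hi (v) := integrable_indicator_mul_adjDeriv hg (measurableSet_halfSpace e) v
  have hx (x : EuclideanSpace ℝ (Fin n)) :
      (halfSpace e).indicator (fun _ => (1 : ℝ)) x * adjDeriv h g x =
      inner ℝ e h * ((halfSpace e).indicator (fun _ => (1 : ℝ)) x * adjDeriv e g x) +
        (halfSpace e).indicator (fun _ => (1 : ℝ)) x * adjDeriv (projAlong e h) g x := by
    conv_lhs => rw [hd, adjDeriv_add, adjDeriv_smul]
    ring
  simp only [hx]
  rw [integral_add ((hi e).const_mul _) (hi _), integral_const_mul,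
    integral_halfSpace_adjDeriv_self hg he, integral_halfSpace_adjDeriv_projAlong hg he]
  ring

end TestFunction

/-- The surface measure of the hyperplane orthogonal to `e`, weighted by the Gaussian density. -/
def hyperplaneMeasure (e : EuclideanSpace ℝ (Fin n)) : Measure (EuclideanSpace ℝ (Fin n)) :=
  (gaussianPDFReal 0 1 0).toNNReal • (γ n).map (projAlong e)

instance (e : EuclideanSpace ℝ (Fin n)) : IsFiniteMeasure (hyperplaneMeasure e) := by
  have := Measure.isProbabilityMeasure_map (μ := γ n) (continuous_projAlong e).measurable.aemeasurable
  unfold hyperplaneMeasure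
  infer_instance

theorem isMeasureDeriv_halfSpace {e : EuclideanSpace ℝ (Fin n)} (he : ‖e‖ = 1) :
    IsMeasureDeriv ((halfSpace e).indicator fun _ => (1 : ℝ))
      (directedMeasure (hyperplaneMeasure e) e) where
  memLp := memLp_indicator_const 2 (measurableSet_halfSpace e) 1 (.inr (measure_ne_top _ _))
  finite_variation := by
    rw [variation_directedMeasure _ he]
    infer_instance
  integral_eq h g hg := by
    rw [component_directedMeasure, VectorMeasure.integral_smul_vectorMeasure,
      vectorIntegral_toSignedMeasure, integral_halfSpace_adjDeriv hg he, neg_neg, smul_eq_mul,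
      hyperplaneMeasure, integral_smul_nnreal_measure,
      integral_map (continuous_projAlong e).measurable.aemeasurable
        hg.contDiff.continuous.aestronglyMeasurable, NNReal.smul_def,
      Real.coe_toNNReal _ (gaussianPDFReal_nonneg _ _ _), smul_eq_mul]

theorem setOf_W_pos_eq_halfSpace (hn : 1 ≤ n) :
    {x | 0 < W n n x} = halfSpace (diagonalUnit n) := by
  ext x
  exact (inner_diagonalUnit_pos_iff hn x).symm

theorem perimeterMeasure_W_pos (hn : 1 ≤ n) :
    perimeterMeasure {x | 0 < W n n x} =
      (gaussianPDFReal 0 1 0).toNNReal • bridgeMeasure n := by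
  have he := norm_diagonalUnit hn
  rw [perimeterMeasure, setOf_W_pos_eq_halfSpace hn, measureDeriv_eq (isMeasureDeriv_halfSpace he),
    variation_directedMeasure _ he]
  rfl

end GaussianWalk

end

/-! ### Assembly -/

theorem mainTheorem5 (n : ℕ) (hn : 1 ≤ n) :
    (GaussianWalk.γ n).real (GaussianWalk.A n) = (Nat.choose (2 * n) n : ℝ) / 4 ^ n ∧
    (∃! D : VectorMeasure (EuclideanSpace ℝ (Fin n)) (EuclideanSpace ℝ (Fin n)),
      GaussianWalk.IsMeasureDeriv
        ({x | 0 < GaussianWalk.W n n x}.indicator fun _ => (1 : ℝ)) D) ∧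
    0 < (GaussianWalk.perimeterMeasure {x | 0 < GaussianWalk.W n n x}).real Set.univ ∧
    GaussianWalk.condProbTerminalZero n (GaussianWalk.A n) = 1 / (n : ℝ) := by
  have hpos : 0 < gaussianPDFReal 0 1 0 := gaussianPDFReal_pos _ _ _ one_ne_zero
  -- The density at `0` is a common factor of numerator and denominator, so it cancels in the
  -- conditional probability.
  have hreal (s : Set (EuclideanSpace ℝ (Fin n))) :
      (GaussianWalk.perimeterMeasure {x | 0 < GaussianWalk.W n n x}).real s =
        gaussianPDFReal 0 1 0 * (GaussianWalk.bridgeMeasure n).real s := by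
    rw [GaussianWalk.perimeterMeasure_W_pos hn, measureReal_nnreal_smul_apply,
      Real.coe_toNNReal _ hpos.le]
  refine ⟨GaussianWalk.gaussian_measureReal_A n, ?_, ?_, ?_⟩
  · have h := GaussianWalk.isMeasureDeriv_halfSpace (GaussianWalk.norm_diagonalUnit hn)
    rw [← GaussianWalk.setOf_W_pos_eq_halfSpace hn] at h
    exact ⟨_, h, fun D hD => hD.unique h⟩
  · rw [hreal]
    simpa using hpos
  · rw [GaussianWalk.condProbTerminalZero, hreal, hreal, probReal_univ, mul_one,
      mul_div_cancel_left₀ _ hpos.ne', GaussianWalk.bridgeMeasure_measureReal_A hn]
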